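/- Let $(M,P,g)$ be a Riemannian almost product manifold with $\operatorname{tr}P=0$, i.e. $M$ is a smooth (Hausdorff, finite-dimensional) manifold without boundary, $g$ is a smooth Riemannian metric and $P$ is a smooth tensor field of type $(1,1)$ with $P^2=\mathrm{id}$, $g(Px,Py)=g(x,y)$ and $\operatorname{tr}P=0$. Let $\nabla$ be the Levi-Civita connection of $g$, put $F(x,y,z)=g\big((\nabla_xP)y,z\big)$, and suppose that $(M,P,g)$ is a $\mathcal W_3$-manifold, i.e. $$F(x,y,z)+F(y,z,x)+F(z,x,y)=0\quad\text{for all } x,y,z.$$ Let $\nabla'$ be the canonical connection of $(M,P,g)$, i.e. the linear connection with $\nabla'P=0$, $\nabla'g=0$ whose torsion $T$, with $T(x,y,z)=g(T(x,y),z)$, satisfies $$T(x,y,z)+T(y,z,x)+T(Px,y,Pz)+T(y,Pz,Px)=0\quad\text{for all } x,y,z.$$ For a linear connection $D$ on $M$ with curvature $R^D(x,y)z=D_xD_yz-D_yD_xz-D_{[x,y]}z$, its scalar curvature is the function $\tau^D=\sum_{i,k}g\big(R^D(e_i,e_k)e_k,e_i\big)$, where $\{e_i\}$ is any $g$-orthonormal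 basis of the tangent space. Then $(M,P,g)$ is a Riemannian $P$-manifold, i.e. $\nabla P=0$, if and only if $\tau^{\nabla'}=\tau^{\nabla}$ at every point of $M$. -/

import Mathlib

open Bundle FiberBundle VectorField
open scoped Manifold ContDiff

noncomputable section RiemannianAlmostProduct

variable {E : Type*} [NormedAddCommGroup E] [NormedSpace ℝ E]
  {H : Type*} [TopologicalSpace H] {I : ModelWithCorners ℝ E H}
  {M : Type*} [TopologicalSpace M] [ChartedSpace H M] [IsManifold I ∞ M]

/-- The vector field `R(X, Y) Z = ∇_X ∇_Y Z - ∇_Y ∇_X Z - ∇_[X, Y] Z` of a linear connection `∇`.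
In Mathlib's convention `cov Z x (X x)` is the value of `∇_X Z` at `x`. -/
def curvatureField (cov : CovariantDerivative I E (TangentSpace I : M → Type _))
    (X Y Z : Π x : M, TangentSpace I x) (x : M) : TangentSpace I x :=
  cov (fun y ↦ cov Z y (Y y)) x (X x) - cov (fun y ↦ cov Z y (X y)) x (Y x)
    - cov Z x (mlieBracket I X Y x)

/-- The curvature tensor `R(u, v) w` at a point `x`, for tangent vectors `u v w`, evaluated by
extending them to vector fields that are smooth near `x`. By tensoriality the choice of
the extensions does not matter. -/
def curvatureAt (cov : CovariantDerivative I E (TangentSpace I : M → Type _)) (x : M)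
    (u v w : TangentSpace I x) : TangentSpace I x :=
  curvatureField cov (extend E u) (extend E v) (extend E w) x

/-- The covariant derivative of a field `P` of endomorphisms of the tangent spaces:
`(∇_u P) v = ∇_u (P V) - P (∇_u V)` for any vector field `V` that extends `v`. -/
def covDerivEndo (cov : CovariantDerivative I E (TangentSpace I : M → Type _))
    (P : Π x : M, TangentSpace I x →L[ℝ] TangentSpace I x) (x : M)
    (u v : TangentSpace I x) : TangentSpace I x :=
  cov (fun y ↦ P y (extend E v y)) x u - P x (cov (extend E v) x u)

/-- The field of endomorphisms `P` is parallel: `∇P = 0`. -/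
def IsParallelEndo (cov : CovariantDerivative I E (TangentSpace I : M → Type _))
    (P : Π x : M, TangentSpace I x →L[ℝ] TangentSpace I x) : Prop :=
  ∀ (x : M) (u v : TangentSpace I x), covDerivEndo cov P x u v = 0

variable [RiemannianBundle (fun x : M ↦ TangentSpace I x)]

/-- `P` is an almost product structure compatible with the Riemannian metric `g`:
a smooth tensor field of type (1,1) with `P² = id`, `g(Pu, Pv) = g(u, v)` and `tr P = 0`. -/
structure IsRiemannianAlmostProduct
    (P : Π x : M, TangentSpace I x →L[ℝ] TangentSpace I x) : Prop where
  smooth : ContMDiff I (I.prod 𝓘(ℝ, E →L[ℝ] E)) ∞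
    (fun x ↦ TotalSpace.mk' (E →L[ℝ] E)
      (E := fun x : M ↦ TangentSpace I x →L[ℝ] TangentSpace I x) x (P x))
  sq : ∀ (x : M) (u : TangentSpace I x), P x (P x u) = u
  inner_map : ∀ (x : M) (u v : TangentSpace I x), inner ℝ (P x u) (P x v) = inner ℝ u v
  trace_eq_zero : ∀ x : M, LinearMap.trace ℝ (TangentSpace I x) (P x).toLinearMap = 0

/-- The tensor `F(u, v, w) = g((∇_u P) v, w)`. -/
def fundamentalF (cov : CovariantDerivative I E (TangentSpace I : M → Type _))
    (P : Π x : M, TangentSpace I x →L[ℝ] TangentSpace I x) (x : M)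
    (u v w : TangentSpace I x) : ℝ :=
  inner ℝ (covDerivEndo cov P x u v) w

/-- The class `W₃`: the cyclic sum of `F` vanishes (`cov` is meant to be the Levi-Civita
connection). -/
def IsW3 (cov : CovariantDerivative I E (TangentSpace I : M → Type _))
    (P : Π x : M, TangentSpace I x →L[ℝ] TangentSpace I x) : Prop :=
  ∀ (x : M) (u v w : TangentSpace I x),
    fundamentalF cov P x u v w + fundamentalF cov P x v w u + fundamentalF cov P x w u v = 0

variable [FiniteDimensional ℝ E]

/-- The Ricci tensor `ρ(v, w) = ∑ᵢ g(R(eᵢ, v) w, eᵢ)`, for an orthonormal basis `eᵢ` of the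
tangent space. -/
def ricciAt (cov : CovariantDerivative I E (TangentSpace I : M → Type _)) (x : M)
    (v w : TangentSpace I x) : ℝ :=
  haveI : FiniteDimensional ℝ (TangentSpace I x) := inferInstanceAs (FiniteDimensional ℝ E)
  ∑ i, inner ℝ (curvatureAt cov x (stdOrthonormalBasis ℝ (TangentSpace I x) i) v w)
    (stdOrthonormalBasis ℝ (TangentSpace I x) i)

/-- The scalar curvature `∑ₖ ρ(eₖ, eₖ)` of a linear connection with respect to the metric. -/
def scalarCurvatureAt (cov : CovariantDerivative I E (TangentSpace I : M → Type _))
    (x : M) : ℝ :=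
  haveI : FiniteDimensional ℝ (TangentSpace I x) := inferInstanceAs (FiniteDimensional ℝ E)
  ∑ k, ricciAt cov x (stdOrthonormalBasis ℝ (TangentSpace I x) k)
    (stdOrthonormalBasis ℝ (TangentSpace I x) k)

variable [IsContMDiffRiemannianBundle I ∞ E (fun x : M ↦ TangentSpace I x)]

/-- The Levi-Civita connection: the smooth linear connection with `∇g = 0` and zero torsion. -/
structure IsLeviCivita (cov : CovariantDerivative I E (TangentSpace I : M → Type _)) : Prop where
  smooth : CovariantDerivative.ContMDiffCovariantDerivative cov ∞
  metric : CovariantDerivative.IsMetricCompatible (V := fun x : M ↦ TangentSpace I x) cov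
  torsion_eq_zero : cov.torsion = 0

/-- A natural connection: a smooth linear connection with `∇'P = 0` and `∇'g = 0`. -/
structure IsNaturalConnection (cov : CovariantDerivative I E (TangentSpace I : M → Type _))
    (P : Π x : M, TangentSpace I x →L[ℝ] TangentSpace I x) : Prop where
  smooth : CovariantDerivative.ContMDiffCovariantDerivative cov ∞
  metric : CovariantDerivative.IsMetricCompatible (V := fun x : M ↦ TangentSpace I x) cov
  parallel : IsParallelEndo cov P

/-- The canonical connection: a natural connection whose torsion satisfies
`T(u, v, w) + T(v, w, u) + T(Pu, v, Pw) + T(v, Pw, Pu) = 0`, where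
`T(u, v, w) = g(T(u, v), w)`. -/
structure IsCanonicalConnection (cov : CovariantDerivative I E (TangentSpace I : M → Type _))
    (P : Π x : M, TangentSpace I x →L[ℝ] TangentSpace I x) : Prop
    extends IsNaturalConnection cov P where
  torsion_identity : ∀ (x : M) (u v w : TangentSpace I x),
    inner ℝ (cov.torsion x u v) w + inner ℝ (cov.torsion x v w) u
      + inner ℝ (cov.torsion x (P x u) v) (P x w)
      + inner ℝ (cov.torsion x v (P x w)) (P x u) = 0

end RiemannianAlmostProduct

/-! Let `A v u = ∇'_u v - ∇_u v`. Both connections are metric, so `⟪A v u, w⟫` is skew in `v` and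
`w`. As `∇'P = 0` and `∇` is torsion-free, `∇P` is a commutator of `P` with `A`, and the torsion of
`∇'` is `A v u - A u v`. The hypotheses thus become pointwise linear relations on `A`. On
eigenvectors of `P` they leave only components of mixed type, subject to `A u v = -A (P v) (P u)`
(`eigenvectors`, `swap`). Consequently `∇P = 0` exactly when `A = 0` (`eq_zero`).

The curvatures of the two connections differ by a derivative of `A` and terms quadratic in `A`. The
derivative is taken with `∇'`, which preserves `P` and `g`, so it inherits the symmetries of `A` and
its traces vanish. The quadratic terms add up to `τ' - τ = Q`, where `Q = ∑ ⟪A (e k) (e i), A (e i)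
(e k)⟫`. The mixed type gives `∑ ‖A (e k) (e i)‖² = 3 Q` (`sum_norm_sq`). Hence `τ' - τ` is a third
of the squared norm of `A`, and vanishes at a point exactly when `A` does. -/

/-! ### Pointwise algebra of the difference tensor. -/

section LinearAlgebra

variable {V : Type*} [NormedAddCommGroup V] [InnerProductSpace ℝ V]
  {P : V →L[ℝ] V} {A : V →L[ℝ] V →L[ℝ] V}

/-- A linear form vanishing on the eigenvectors of an involution vanishes. -/
theorem eq_zero_of_involution_eigenvectors (hsq : ∀ u, P (P u) = u) (f : V →ₗ[ℝ] ℝ)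
    (h : ∀ (a : ℝ) u, a = 1 ∨ a = -1 → P u = a • u → f u = 0) (u : V) : f u = 0 := by
  have h1 := h 1 (u + P u) (Or.inl rfl) (by simp [hsq, add_comm])
  have h2 := h (-1) (u - P u) (Or.inr rfl) (by simp [hsq])
  rw [map_add] at h1
  rw [map_sub] at h2
  linarith

/-- A trilinear form vanishing on the eigenvectors of an involution vanishes. -/
theorem trilinear_eq_zero_of_involution_eigenvectors (hsq : ∀ u, P (P u) = u)
    (f : V →ₗ[ℝ] V →ₗ[ℝ] V →ₗ[ℝ] ℝ)
    (h : ∀ (a b c : ℝ) u v w, a = 1 ∨ a = -1 → b = 1 ∨ b = -1 → c = 1 ∨ c = -1 →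
      P u = a • u → P v = b • v → P w = c • w → f u v w = 0) (u v w : V) : f u v w = 0 := by
  refine eq_zero_of_involution_eigenvectors hsq ((f.flip v).flip w) (fun a u ha hu ↦ ?_) u
  refine eq_zero_of_involution_eigenvectors hsq ((f u).flip w) (fun b v hb hv ↦ ?_) v
  exact eq_zero_of_involution_eigenvectors hsq (f u v) (fun c w hc hw ↦ h a b c u v w ha hb hc
    hu hv hw) w

theorem inner_involution_left (hsq : ∀ u, P (P u) = u)
    (hinner : ∀ u v, inner ℝ (P u) (P v) = inner ℝ u v) (u v : V) :
    inner ℝ (P u) v = inner ℝ u (P v) := by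
  rw [← hinner u (P v), hsq]

variable (A) in
/-- The trilinear form `(u, v, w) ↦ ⟪A v u, w⟫`. -/
noncomputable def innerForm : V →ₗ[ℝ] V →ₗ[ℝ] V →ₗ[ℝ] ℝ :=
  LinearMap.mk₂ ℝ (fun u v ↦ ((innerSL ℝ (A v u) : V →L[ℝ] ℝ) : V →ₗ[ℝ] ℝ))
    (by intros; ext; simp) (by intros; ext; simp)
    (by intros; ext; simp) (by intros; ext; simp)

@[simp]
theorem innerForm_apply (u v w : V) : innerForm A u v w = inner ℝ (A v u) w := rfl

variable (P A) in
/-- The pointwise relations between an almost product structure `P` and the difference tensor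
`A v u = ∇'_u v - ∇_u v` of the canonical and the Levi-Civita connections of a `W₃`-manifold. -/
structure IsW3Difference : Prop where
  sq : ∀ u, P (P u) = u
  inner_map : ∀ u v, inner ℝ (P u) (P v) = inner ℝ u v
  skew : ∀ u v w, inner ℝ (A v u) w = -inner ℝ (A w u) v
  cyclic : ∀ u v w, inner ℝ (P (A v u) - A (P v) u) w + inner ℝ (P (A w v) - A (P w) v) u
    + inner ℝ (P (A u w) - A (P u) w) v = 0
  torsion : ∀ u v w, inner ℝ (A v u - A u v) w + inner ℝ (A w v - A v w) u
    + inner ℝ (A v (P u) - A (P u) v) (P w) + inner ℝ (A (P w) v - A v (P w)) (P u) = 0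

namespace IsW3Difference

theorem cyclic_eigenvectors (h : IsW3Difference P A) {a b c : ℝ} {u v w : V}
    (hu : P u = a • u) (hv : P v = b • v) (hw : P w = c • w) :
    (c - b) * inner ℝ (A v u) w + (a - c) * inner ℝ (A w v) u
      + (b - a) * inner ℝ (A u w) v = 0 := by
  have := h.cyclic u v w
  simp only [inner_sub_left, inner_involution_left h.sq h.inner_map, hu, hv, hw, map_smul,
    FunLike.coe_smul, Pi.smul_apply, inner_smul_left, inner_smul_right, RCLike.conj_to_real]
    at this
  linarith

theorem torsion_eigenvectors (h : IsW3Difference P A) {a c : ℝ} {u w : V} (v : V)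
    (hu : P u = a • u) (hw : P w = c • w) :
    (1 + a * c) * (inner ℝ (A v u) w - inner ℝ (A u v) w + inner ℝ (A w v) u
      - inner ℝ (A v w) u) = 0 := by
  have := h.torsion u v w
  simp only [inner_sub_left, hu, hw, map_smul,
    FunLike.coe_smul, Pi.smul_apply, inner_smul_left, inner_smul_right, RCLike.conj_to_real]
    at this
  linarith

/-- By skewness only three numbers matter: `α = ⟪A v u, w⟫`, `β = ⟪A w v, u⟫`, `γ = ⟪A u w, v⟫`. The
torsion relations read `(1 + b c)(2α + β + γ) = 0` and its analogues, with `2β` for `1 + a c` and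
`2γ` for `1 + a b`. If `a = b = c`, all three apply and force zero. Otherwise one survives and the
cyclic identity equates two of the unknowns, leaving a single free parameter. -/
theorem eigenvectors (h : IsW3Difference P A) {a b c : ℝ} {u v w : V}
    (ha : a = 1 ∨ a = -1) (hb : b = 1 ∨ b = -1) (hc : c = 1 ∨ c = -1)
    (hu : P u = a • u) (hv : P v = b • v) (hw : P w = c • w) :
    inner ℝ (A u v) w = -(a * b * inner ℝ (A v u) w) ∧
      (a * b + b * c + a * c + 1) * inner ℝ (A v u) w = 0 := by
  have s1 := h.skew u v w
  have s2 := h.skew v u w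
  have s3 := h.skew w u v
  have c1 := h.cyclic_eigenvectors hu hv hw
  have c2 := h.cyclic_eigenvectors hv hu hw
  have t1 := h.torsion_eigenvectors v hu hw
  have t2 := h.torsion_eigenvectors u hv hw
  have t3 := h.torsion_eigenvectors w hu hv
  constructor <;> rcases ha with rfl | rfl <;> rcases hb with rfl | rfl <;>
    rcases hc with rfl | rfl <;> linarith

theorem swap_inner (h : IsW3Difference P A) (u v w : V) :
    inner ℝ (A u v) w = -inner ℝ (A (P v) (P u)) w := by
  have key := trilinear_eq_zero_of_involution_eigenvectors h.sq
    ((innerForm A).flip + (innerForm A).compl₁₂ (P : V →ₗ[ℝ] V) (P : V →ₗ[ℝ] V))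
    (fun a b c u v w ha hb hc hu hv hw ↦ ?_) u v w
  · simp at key
    linarith
  · have := (h.eigenvectors ha hb hc hu hv hw).1
    simp [hu, hv, this]
    ring

theorem swap (h : IsW3Difference P A) (u v : V) : A u v = -A (P v) (P u) :=
  ext_inner_right ℝ fun w ↦ by rw [h.swap_inner, inner_neg_left]

/-- For signs, `a b + b c + a c` is `3` if all agree and `-1` otherwise; components of the first
kind vanish. -/
theorem type_sum (h : IsW3Difference P A) (u v w : V) :
    inner ℝ (A (P v) (P u)) w + inner ℝ (A (P v) u) (P w) + inner ℝ (A v (P u)) (P w)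
      = -inner ℝ (A v u) w := by
  have key := trilinear_eq_zero_of_involution_eigenvectors h.sq
    ((innerForm A).compl₁₂ (P : V →ₗ[ℝ] V) (P : V →ₗ[ℝ] V)
      + ((innerForm A).compl₁₂ LinearMap.id (P : V →ₗ[ℝ] V)).compr₂
        (LinearMap.lcomp ℝ ℝ (P : V →ₗ[ℝ] V))
      + ((innerForm A).compl₁₂ (P : V →ₗ[ℝ] V) LinearMap.id).compr₂
        (LinearMap.lcomp ℝ ℝ (P : V →ₗ[ℝ] V)) + innerForm A)
    (fun a b c u v w ha hb hc hu hv hw ↦ ?_) u v w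
  · simp at key
    linarith
  · have := (h.eigenvectors ha hb hc hu hv hw).2
    simp [hu, hv, hw]
    linarith

/-- The commutator condition leaves only `b = c`; applied after exchanging `u` and `v`, which costs
a sign, it leaves only `a = c`. The remaining pure type `a = b = c` is already excluded. -/
theorem eq_zero (h : IsW3Difference P A) (hF : ∀ u v, P (A v u) - A (P v) u = 0) (u v : V) :
    A v u = 0 := by
  refine ext_inner_right ℝ fun w ↦ ?_
  rw [inner_zero_left]
  refine trilinear_eq_zero_of_involution_eigenvectors h.sq (innerForm A)
    (fun a b c u v w ha hb hc hu hv hw ↦ ?_) u v w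
  obtain ⟨e1, e2⟩ := h.eigenvectors ha hb hc hu hv hw
  have f1 : (c - b) * inner ℝ (A v u) w = 0 := by
    have := congrArg (fun z ↦ inner ℝ z w) (hF u v)
    simp only [inner_sub_left, inner_involution_left h.sq h.inner_map, hv, hw, map_smul,
      FunLike.coe_smul, Pi.smul_apply, inner_smul_left, inner_smul_right, RCLike.conj_to_real,
      inner_zero_left] at this
    linarith
  have f2 : (c - a) * inner ℝ (A u v) w = 0 := by
    have := congrArg (fun z ↦ inner ℝ z w) (hF v u)
    simp only [inner_sub_left, inner_involution_left h.sq h.inner_map, hu, hw, map_smul,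
      FunLike.coe_smul, Pi.smul_apply, inner_smul_left, inner_smul_right, RCLike.conj_to_real,
      inner_zero_left] at this
    linarith
  rw [innerForm_apply]
  rcases ha with rfl | rfl <;> rcases hb with rfl | rfl <;>
    rcases hc with rfl | rfl <;> linarith

end IsW3Difference

variable {ι : Type*} [Fintype ι]

/-- The trace of a bilinear form with values in a module is invariant under an isometric involution. -/
theorem sum_bilinear_isometry {W : Type*} [AddCommGroup W] [Module ℝ W]
    (hinner : ∀ u v, inner ℝ (P u) (P v) = inner ℝ u v) (hsq : ∀ u, P (P u) = u)
    (e : OrthonormalBasis ι ℝ V) (B : V →ₗ[ℝ] V →ₗ[ℝ] W) :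
    ∑ i, B (P (e i)) (P (e i)) = ∑ i, B (e i) (e i) := by
  classical
  have expand (i : ι) : B (P (e i)) (P (e i))
      = ∑ j, ∑ k, (inner ℝ (P (e j)) (e i) * inner ℝ (e i) (P (e k))) • B (e j) (e k) := by
    conv_lhs => rw [← e.sum_repr' (P (e i))]
    simp only [map_sum, map_smul, LinearMap.sum_apply, LinearMap.smul_apply, Finset.smul_sum,
      smul_smul, inner_involution_left hsq hinner]
    rw [Finset.sum_comm]
    refine Finset.sum_congr rfl fun j _ ↦ Finset.sum_congr rfl fun k _ ↦ ?_
    rw [← inner_involution_left hsq hinner (e i) (e k), real_inner_comm (P (e i)) (e k), mul_comm]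
  simp_rw [expand]
  rw [Finset.sum_comm]
  refine Finset.sum_congr rfl fun j _ ↦ ?_
  rw [Finset.sum_comm]
  simp_rw [← Finset.sum_smul, e.sum_inner_mul_inner, hinner, e.inner_eq_ite]
  simp

end LinearAlgebra

/-! ### Traces of expressions in the difference tensor. -/

namespace IsW3Difference

variable {V : Type*} [NormedAddCommGroup V] [InnerProductSpace ℝ V]
  {P : V →L[ℝ] V} {A : V →L[ℝ] V →L[ℝ] V} {ι : Type*} [Fintype ι]

/-- A bilinear map that changes sign under `(u, v) ↦ (P v, P u)` is trace-free. -/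
theorem sum_bilinear_eq_zero {W : Type*} [AddCommGroup W] [Module ℝ W]
    (h : IsW3Difference P A) (e : OrthonormalBasis ι ℝ V) (B : V →ₗ[ℝ] V →ₗ[ℝ] W)
    (hB : ∀ u v, B u v = -B (P v) (P u)) : ∑ i, B (e i) (e i) = 0 := by
  have h1 := sum_bilinear_isometry h.inner_map h.sq e B
  have h2 : ∑ i, B (e i) (e i) = -∑ i, B (P (e i)) (P (e i)) := by
    rw [← Finset.sum_neg_distrib]
    exact Finset.sum_congr rfl fun i _ ↦ hB _ _
  rw [h1] at h2
  have h3 : (2 : ℝ) • ∑ i, B (e i) (e i) = 0 := by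
    rw [two_smul]
    nth_rewrite 1 [h2]
    simp
  exact (smul_eq_zero.1 h3).resolve_left two_ne_zero

theorem sum_diag (h : IsW3Difference P A) (e : OrthonormalBasis ι ℝ V) :
    ∑ i, A (e i) (e i) = 0 :=
  h.sum_bilinear_eq_zero e
    (LinearMap.mk₂ ℝ (fun u v ↦ A u v) (by simp) (by simp) (by simp) (by simp)) h.swap

/-- Expand both inner products along `e j`; skewness of both factors on the left exchanges the
indices `k` and `j`. -/
theorem sum_swap_eq (h : IsW3Difference P A) (e : OrthonormalBasis ι ℝ V) :
    ∑ k, ∑ i, inner ℝ (A (P (e k)) (P (e i))) (A (e k) (e i))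
      = ∑ k, ∑ i, inner ℝ (A (e k) (P (e i))) (P (A (e k) (e i))) := by
  have lhs (k i : ι) : inner ℝ (A (P (e k)) (P (e i))) (A (e k) (e i))
      = ∑ j, inner ℝ (A (e j) (P (e i))) (P (e k)) * inner ℝ (e k) (A (e j) (e i)) := by
    rw [← e.sum_inner_mul_inner]
    refine Finset.sum_congr rfl fun j _ ↦ ?_
    rw [h.skew, real_inner_comm (A (e k) (e i)), h.skew (e i) (e k), real_inner_comm (e k)]
    ring
  have rhs (k i : ι) : inner ℝ (A (e k) (P (e i))) (P (A (e k) (e i)))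
      = ∑ j, inner ℝ (A (e k) (P (e i))) (P (e j)) * inner ℝ (e j) (A (e k) (e i)) := by
    rw [← inner_involution_left h.sq h.inner_map, ← e.sum_inner_mul_inner]
    refine Finset.sum_congr rfl fun j _ ↦ ?_
    rw [inner_involution_left h.sq h.inner_map]
  simp_rw [lhs, rhs]
  have comm (f : ι → ι → ι → ℝ) : ∑ k, ∑ i, ∑ j, f k i j = ∑ j, ∑ i, ∑ k, f k i j := by
    rw [Finset.sum_comm, Finset.sum_comm (s := Finset.univ)
      (t := Finset.univ) (f := fun j i ↦ ∑ k, f k i j)]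
    exact Finset.sum_congr rfl fun i _ ↦ Finset.sum_comm
  exact comm _

/-- Apply `swap` to both factors, absorb `P` into the orthonormal basis in the index `i`, then
rename indices and use that `P` is symmetric. -/
theorem sum_right_eq (h : IsW3Difference P A) (e : OrthonormalBasis ι ℝ V) :
    ∑ k, ∑ i, inner ℝ (A (P (e k)) (e i)) (P (A (e k) (e i)))
      = ∑ k, ∑ i, inner ℝ (A (e k) (P (e i))) (P (A (e k) (e i))) := by
  have step (k i : ι) : inner ℝ (A (P (e k)) (e i)) (P (A (e k) (e i)))
      = inner ℝ (A (P (e i)) (e k)) (P (A (P (e i)) (P (e k)))) := by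
    rw [h.swap (P (e k)) (e i), h.swap (e k) (e i), h.sq]
    simp
  simp_rw [step]
  have inv (k : ι) : ∑ i, inner ℝ (A (P (e i)) (e k)) (P (A (P (e i)) (P (e k))))
      = ∑ i, inner ℝ (A (e i) (e k)) (P (A (e i) (P (e k)))) :=
    sum_bilinear_isometry h.inner_map h.sq e
      (LinearMap.mk₂ ℝ (fun u v ↦ inner ℝ (A u (e k)) (P (A v (P (e k)))))
        (by simp [inner_add_left]) (by simp [inner_smul_left])
        (by simp [inner_add_right]) (by simp [inner_smul_right]))
  simp_rw [inv]
  rw [Finset.sum_comm]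
  refine Finset.sum_congr rfl fun k _ ↦ Finset.sum_congr rfl fun i _ ↦ ?_
  rw [← inner_involution_left h.sq h.inner_map, real_inner_comm]

/-- The factor 3 counts the terms of `type_sum`: after tracing they are all equal, and `swap`
identifies the first with minus the sum on the right. -/
theorem sum_norm_sq (h : IsW3Difference P A) (e : OrthonormalBasis ι ℝ V) :
    ∑ k, ∑ i, ‖A (e k) (e i)‖ ^ 2
      = 3 * ∑ k, ∑ i, inner ℝ (A (e k) (e i)) (A (e i) (e k)) := by
  have key (k i : ι) : ‖A (e k) (e i)‖ ^ 2
      = -(inner ℝ (A (P (e k)) (P (e i))) (A (e k) (e i))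
        + inner ℝ (A (P (e k)) (e i)) (P (A (e k) (e i)))
        + inner ℝ (A (e k) (P (e i))) (P (A (e k) (e i)))) := by
    rw [h.type_sum, neg_neg, real_inner_self_eq_norm_sq]
  have swap (k i : ι) : inner ℝ (A (P (e k)) (P (e i))) (A (e k) (e i))
      = -inner ℝ (A (e k) (e i)) (A (e i) (e k)) := by
    rw [h.swap (e i) (e k), inner_neg_right, neg_neg, real_inner_comm]
  simp_rw [key, Finset.sum_neg_distrib, Finset.sum_add_distrib]
  rw [h.sum_right_eq, ← h.sum_swap_eq]
  simp_rw [swap, Finset.sum_neg_distrib]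
  ring

theorem sum_inner_apply_apply (h : IsW3Difference P A) (e : OrthonormalBasis ι ℝ V) :
    ∑ k, ∑ i, inner ℝ (A (e k) (A (e k) (e i))) (e i)
      = ∑ k, ∑ i, inner ℝ (A (e k) (e i)) (A (e i) (e k)) := by
  have lhs (k i : ι) : inner ℝ (A (e k) (A (e k) (e i))) (e i)
      = ∑ j, inner ℝ (A (e j) (e i)) (e k) * inner ℝ (e k) (A (e i) (e j)) := by
    conv_lhs => rw [← e.sum_repr' (A (e k) (e i))]
    simp only [map_sum, map_smul, sum_inner, inner_smul_left, RCLike.conj_to_real]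
    refine Finset.sum_congr rfl fun j _ ↦ ?_
    rw [h.skew (e j), real_inner_comm (A (e k) (e i)), h.skew (e i) (e k),
      real_inner_comm (A (e i) (e j)) (e k)]
    ring
  have rhs (k i : ι) : inner ℝ (A (e k) (e i)) (A (e i) (e k))
      = ∑ j, inner ℝ (A (e k) (e i)) (e j) * inner ℝ (e j) (A (e i) (e k)) :=
    (e.sum_inner_mul_inner _ _).symm
  simp_rw [lhs, rhs]
  have comm (f : ι → ι → ι → ℝ) : ∑ k, ∑ i, ∑ j, f k i j = ∑ j, ∑ i, ∑ k, f k i j := by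
    rw [Finset.sum_comm, Finset.sum_comm (s := Finset.univ)
      (t := Finset.univ) (f := fun j i ↦ ∑ k, f k i j)]
    exact Finset.sum_congr rfl fun i _ ↦ Finset.sum_comm
  exact comm _

/-- Skewness is used once here, hence the sign; in `sum_inner_apply_apply` it is used twice. -/
theorem sum_inner_apply_swap (h : IsW3Difference P A) (e : OrthonormalBasis ι ℝ V) :
    ∑ k, ∑ i, inner ℝ (A (e k) (A (e i) (e k))) (e i)
      = -∑ k, ∑ i, inner ℝ (A (e k) (e i)) (A (e i) (e k)) := by
  have lhs (k i : ι) : inner ℝ (A (e k) (A (e i) (e k))) (e i)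
      = ∑ j, -(inner ℝ (A (e k) (e j)) (e i) * inner ℝ (e i) (A (e j) (e k))) := by
    conv_lhs => rw [← e.sum_repr' (A (e i) (e k))]
    simp only [map_sum, map_smul, sum_inner, inner_smul_left, RCLike.conj_to_real]
    refine Finset.sum_congr rfl fun j _ ↦ ?_
    rw [real_inner_comm (A (e i) (e k)), h.skew (e k) (e i), real_inner_comm (e i)]
    ring
  simp_rw [lhs, Finset.sum_neg_distrib, ← e.sum_inner_mul_inner (A _ _) (A _ _)]
  refine congrArg _ (Finset.sum_congr rfl fun k _ ↦ Finset.sum_comm)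

/-- The trace identity comparing the scalar curvatures: `R z y x` and `R' z y x` stand for the
curvatures `R(x, y) z` of two connections with difference tensor `A`, and `D z y x` for the
derivative of `A` in the direction `x`. -/
theorem sum_curvature_sub (h : IsW3Difference P A) (e : OrthonormalBasis ι ℝ V)
    (D : V →ₗ[ℝ] V →ₗ[ℝ] V →ₗ[ℝ] V) (hD : ∀ z y x, D z y x = -D (P y) (P z) x)
    (hDskew : ∀ z y x w, inner ℝ (D z y x) w = -inner ℝ (D w y x) z)
    (R R' : V → V → V → V)
    (hR : ∀ z y x, R z y x = R' z y x - D z y x + D z x y - A z (A y x - A x y)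
      + A (A z y) x - A (A z x) y) :
    3 * (∑ k, ∑ i, inner ℝ (R' (e k) (e k) (e i)) (e i)
      - ∑ k, ∑ i, inner ℝ (R (e k) (e k) (e i)) (e i)) = ∑ k, ∑ i, ‖A (e k) (e i)‖ ^ 2 := by
  have dsum (x : V) : ∑ k, D (e k) (e k) x = 0 :=
    h.sum_bilinear_eq_zero e (D.compr₂ (LinearMap.applyₗ x)) fun u v ↦ hD u v x
  have d1 : ∑ k, ∑ i, inner ℝ (D (e k) (e k) (e i)) (e i) = 0 := by
    rw [Finset.sum_comm]
    simp_rw [← sum_inner, dsum, inner_zero_left, Finset.sum_const_zero]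
  -- Skewness moves the contraction onto the first two arguments of `D`, where it is trace-free.
  have d2 : ∑ k, ∑ i, inner ℝ (D (e k) (e i) (e k)) (e i) = 0 := by
    simp_rw [fun k i ↦ hDskew (e k) (e i) (e k) (e i), Finset.sum_neg_distrib, ← sum_inner, dsum,
      inner_zero_left, Finset.sum_const_zero, neg_zero]
  have d3 : ∑ k, ∑ i, inner ℝ (A (A (e k) (e k)) (e i)) (e i) = 0 := by
    rw [Finset.sum_comm]
    refine Finset.sum_eq_zero fun i _ ↦ ?_
    rw [← sum_inner]
    have := congrArg (fun z ↦ A z (e i)) (h.sum_diag e)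
    simp only [map_sum, map_zero, FunLike.coe_zero, Pi.zero_apply,
      sum_apply] at this
    rw [this, inner_zero_left]
  have d4 : ∑ k, ∑ i, inner ℝ (A (A (e k) (e i)) (e k)) (e i)
      = -∑ k, ∑ i, inner ℝ (A (e k) (e i)) (A (e i) (e k)) := by
    simp_rw [fun k i ↦ h.skew (e k) (A (e k) (e i)) (e i), Finset.sum_neg_distrib,
      real_inner_comm]
  rw [h.sum_norm_sq]
  simp only [hR, map_sub, inner_sub_left, inner_add_left, Finset.sum_sub_distrib,
    Finset.sum_add_distrib]
  -- The torsion term contributes `-2 Q` and the last quadratic term `+Q`, so `τ = τ' - Q`.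
  rw [h.sum_inner_apply_apply, h.sum_inner_apply_swap, d1, d2, d3, d4]
  ring

end IsW3Difference

/-! ### Locality and smoothness of covariant derivatives. -/

section SmoothLocality

open Filter Topology

variable {E : Type*} [NormedAddCommGroup E] [NormedSpace ℝ E]
  {H : Type*} [TopologicalSpace H] {I : ModelWithCorners ℝ E H}
  {M : Type*} [TopologicalSpace M] [ChartedSpace H M] [IsManifold I ∞ M]

/-- Covariant derivatives only depend on germs of sections. -/
theorem CovariantDerivative.congr_of_eventuallyEq
    (cov : CovariantDerivative I E (TangentSpace I : M → Type _))
    {Y Z : Π x : M, TangentSpace I x} {x : M}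
    (hY : MDiffAt (T% Y) x) (hYZ : ∀ᶠ y in 𝓝 x, Y y = Z y) : cov Y x = cov Z x := by
  refine cov.isCovariantDerivativeOnUniv.congr_of_eventuallyEq hY ?_ univ_mem hYZ
  refine hY.congr_of_eventuallyEq ?_
  filter_upwards [hYZ] with y hy
  rw [hy]

theorem CovariantDerivative.apply_sub
    (cov : CovariantDerivative I E (TangentSpace I : M → Type _))
    {Y Z : Π x : M, TangentSpace I x} {x : M}
    (hY : MDiffAt (T% Y) x) (hZ : MDiffAt (T% Z) x) :
    cov (fun y ↦ Y y - Z y) x = cov Y x - cov Z x := by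
  have h : MDiffAt (T% (fun y ↦ Y y - Z y)) x := mdifferentiableAt_sub_section hY hZ
  have h' := cov.isCovariantDerivativeOnUniv.add h hZ
  have e : (fun y ↦ Y y - Z y) + Z = Y := by ext y; simp
  rw [e] at h'
  rw [h', add_sub_cancel_right]

theorem eventually_contMDiffAt_extend {x : M} (v : TangentSpace I x) :
    ∀ᶠ y in 𝓝 x, CMDiffAt ∞ (T% (extend E v)) y := by
  obtain ⟨s, hs, h⟩ := exists_contMDiffOn_extend (k := ∞) I E v
  filter_upwards [eventually_mem_nhds_iff.2 hs] with y hy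
  exact h.contMDiffAt hy

variable [FiniteDimensional ℝ E] [T2Space M]

/-- The covariant derivative of a section that is smooth near `x` is smooth at `x`. -/
theorem CovariantDerivative.ContMDiffCovariantDerivative.contMDiffAt
    {cov : CovariantDerivative I E (TangentSpace I : M → Type _)}
    (hcov : CovariantDerivative.ContMDiffCovariantDerivative cov ∞)
    {Z : Π x : M, TangentSpace I x} {x : M} (hZ : ∀ᶠ y in 𝓝 x, CMDiffAt ∞ (T% Z) y) :
    ContMDiffAt I (I.prod 𝓘(ℝ, E →L[ℝ] E)) ∞
      (fun y ↦ TotalSpace.mk' (E →L[ℝ] E)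
        (E := fun y : M ↦ TangentSpace I y →L[ℝ] TangentSpace I y) y (cov Z y)) x := by
  obtain ⟨U, hU, hUo, hxU⟩ := eventually_nhds_iff.1 hZ
  -- Smoothness of the connection is applied to global sections, so `Z` is cut off by a bump
  -- function that equals 1 near `x`.
  obtain ⟨ψ, hψ⟩ : ∃ ψ : SmoothBumpFunction I x, tsupport ψ ⊆ U := by
    obtain ⟨ψ, -, hψ⟩ := (SmoothBumpFunction.nhds_basis_tsupport (I := I) x).mem_iff.1
      (hUo.mem_nhds hxU)
    exact ⟨ψ, hψ⟩
  have hglobal : CMDiff ∞ (T% ((ψ : M → ℝ) • Z)) :=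
    ContMDiffOn.smul_section_of_tsupport ψ.contMDiff.contMDiffOn hUo hψ
      fun y hy ↦ (hU y hy).contMDiffWithinAt
  have hsmooth := hcov.contMDiff.contMDiff (σ := (ψ : M → ℝ) • Z) hglobal.contMDiffOn
  refine (hsmooth.contMDiffAt univ_mem).congr_of_eventuallyEq ?_
  filter_upwards [ψ.eventuallyEq_one.eventually_nhds, hZ] with y hy hZy
  refine congrArg _ (cov.congr_of_eventuallyEq (hZy.mdifferentiableAt (by simp)) ?_)
  filter_upwards [hy] with z hz
  simp [hz]

theorem CovariantDerivative.ContMDiffCovariantDerivative.eventually_contMDiffAt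
    {cov : CovariantDerivative I E (TangentSpace I : M → Type _)}
    (hcov : CovariantDerivative.ContMDiffCovariantDerivative cov ∞)
    {Y Z : Π x : M, TangentSpace I x} {x : M} (hY : ∀ᶠ y in 𝓝 x, CMDiffAt ∞ (T% Y) y)
    (hZ : ∀ᶠ y in 𝓝 x, CMDiffAt ∞ (T% Z) y) :
    ∀ᶠ y in 𝓝 x, CMDiffAt ∞ (T% (fun y ↦ cov Z y (Y y))) y := by
  filter_upwards [hY, hZ.eventually_nhds] with y hYy hZy
  exact (hcov.contMDiffAt hZy).clm_bundle_apply hYy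

end SmoothLocality

/-! ### The difference tensor of two connections. -/

section DifferenceTensor

open Filter Topology

variable {E : Type*} [NormedAddCommGroup E] [NormedSpace ℝ E] [FiniteDimensional ℝ E]
  {H : Type*} [TopologicalSpace H] {I : ModelWithCorners ℝ E H}
  {M : Type*} [TopologicalSpace M] [ChartedSpace H M] [IsManifold I ∞ M]
  {cov cov' : CovariantDerivative I E (TangentSpace I : M → Type _)}
  {X Y Z : Π x : M, TangentSpace I x} {x : M}

theorem CovariantDerivative.difference_apply_section (hZ : MDiffAt (T% Z) x) :
    cov'.difference cov x (Z x) = cov' Z x - cov Z x :=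
  IsCovariantDerivativeOn.difference_apply cov'.isCovariantDerivativeOnUniv
    cov.isCovariantDerivativeOnUniv trivial hZ

theorem CovariantDerivative.difference_apply_vector (u v : TangentSpace I x) :
    cov'.difference cov x v u = cov' (extend E v) x u - cov (extend E v) x u := by
  have h := difference_apply_section (cov := cov) (cov' := cov')
    (mdifferentiableAt_extend I E v)
  rw [extend_apply_self] at h
  rw [h]
  rfl

variable [T2Space M]

theorem eventually_contMDiffAt_difference
    (hcov : CovariantDerivative.ContMDiffCovariantDerivative cov ∞)
    (hcov' : CovariantDerivative.ContMDiffCovariantDerivative cov' ∞)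
    (hY : ∀ᶠ y in 𝓝 x, CMDiffAt ∞ (T% Y) y) (hZ : ∀ᶠ y in 𝓝 x, CMDiffAt ∞ (T% Z) y) :
    ∀ᶠ y in 𝓝 x, CMDiffAt ∞ (T% (fun y ↦ cov'.difference cov y (Z y) (Y y))) y := by
  filter_upwards [hcov.eventually_contMDiffAt hY hZ, hcov'.eventually_contMDiffAt hY hZ,
    hZ.eventually_nhds] with y h h' hZy
  refine (h'.sub_section h).congr_of_eventuallyEq ?_
  filter_upwards [hZy] with z hz
  rw [CovariantDerivative.difference_apply_section (hz.mdifferentiableAt (by simp))]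
  rfl

/-- The difference tensor of two smooth connections sends differentiable fields to differentiable
fields. -/
theorem mdifferentiableAt_difference
    (hcov : CovariantDerivative.ContMDiffCovariantDerivative cov ∞)
    (hcov' : CovariantDerivative.ContMDiffCovariantDerivative cov' ∞)
    (hY : MDiffAt (T% Y) x) (hZ : MDiffAt (T% Z) x) :
    MDiffAt (T% (fun y ↦ cov'.difference cov y (Z y) (Y y))) x := by
  let t := trivializationAt E (TangentSpace I : M → Type _) x
  have hx : x ∈ t.baseSet := mem_baseSet_trivializationAt E (TangentSpace I : M → Type _) x
  let b := Module.finBasis ℝ E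
  have hframe (i) : ∀ᶠ y in 𝓝 x, CMDiffAt ∞ (T% (t.localFrame b i)) y := by
    filter_upwards [t.open_baseSet.mem_nhds hx] with y hy
    exact contMDiffAt_localFrame_of_mem ∞ t b i hy
  let c {W : Π x : M, TangentSpace I x} (hW : MDiffAt (T% W) x) (i) :=
    mdifferentiableAt_localFrameCoeff (I := I) b hx hW i
  -- Expanding in a smooth local frame separates the coefficients, only differentiable at `x`, from
  -- the smooth values of the tensor on the frame.
  have hsum : MDiffAt (T% (fun y ↦ ∑ i, t.localFrameCoeff I b i y (Z y) •
      ∑ j, t.localFrameCoeff I b j y (Y y) •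
        cov'.difference cov y (t.localFrame b i y) (t.localFrame b j y))) x := by
    refine MDifferentiableAt.sum_section fun i _ ↦ (c hZ i).smul_section ?_
    refine MDifferentiableAt.sum_section fun j _ ↦ (c hY j).smul_section ?_
    exact (eventually_contMDiffAt_difference hcov hcov' (hframe j) (hframe i)).self_of_nhds
      |>.mdifferentiableAt (by simp)
  refine hsum.congr_of_eventuallyEq ?_
  filter_upwards [t.open_baseSet.mem_nhds hx] with y hy
  refine congrArg _ ?_
  conv_lhs => rw [t.eq_sum_localFrameCoeff_smul (I := I) (b := b) (s := Z) hy,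
    t.eq_sum_localFrameCoeff_smul (I := I) (b := b) (s := Y) hy]
  simp only [map_sum, map_smul, sum_apply, FunLike.coe_smul, Pi.smul_apply, Finset.smul_sum]
  rw [Finset.sum_comm]
  exact Finset.sum_congr rfl fun i _ ↦ Finset.sum_congr rfl fun j _ ↦ smul_comm _ _ _

end DifferenceTensor

/-! ### The derivative of the difference tensor and the comparison of curvatures. -/

noncomputable section DerivativeOfDifference

open Filter Topology

variable {E : Type*} [NormedAddCommGroup E] [NormedSpace ℝ E] [FiniteDimensional ℝ E]
  {H : Type*} [TopologicalSpace H] {I : ModelWithCorners ℝ E H}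
  {M : Type*} [TopologicalSpace M] [ChartedSpace H M] [IsManifold I ∞ M]
  {cov cov' : CovariantDerivative I E (TangentSpace I : M → Type _)}
  {X Y Z : Π x : M, TangentSpace I x} {x : M}

variable (cov cov') in
/-- The value `(∇'_u A)(Z, Y)` of the covariant derivative of the difference tensor `A = ∇' - ∇`,
as an operation on vector fields. -/
def derivDifferenceField (x : M) (u : TangentSpace I x) (Z Y : Π x : M, TangentSpace I x) :
    TangentSpace I x :=
  cov' (fun y ↦ cov'.difference cov y (Z y) (Y y)) x u
    - cov'.difference cov x (cov' Z x u) (Y x) - cov'.difference cov x (Z x) (cov' Y x u)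

variable [T2Space M]

theorem tensorialAt_derivDifferenceField_left
    (hcov : CovariantDerivative.ContMDiffCovariantDerivative cov ∞)
    (hcov' : CovariantDerivative.ContMDiffCovariantDerivative cov' ∞) (u : TangentSpace I x)
    (hY : MDiffAt (T% Y) x) :
    TensorialAt I E (derivDifferenceField cov cov' x u · Y) x where
  smul {f Z} hf hZ := by
    have h : (fun y ↦ cov'.difference cov y ((f • Z) y) (Y y))
        = f • fun y ↦ cov'.difference cov y (Z y) (Y y) := by
      ext y
      simp
    have h1 := cov'.isCovariantDerivativeOnUniv.leibniz
      (mdifferentiableAt_difference hcov hcov' hY hZ) hf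
    have h2 := cov'.isCovariantDerivativeOnUniv.leibniz hZ hf
    simp only [derivDifferenceField, h, h1, h2]
    simp
    module
  add {Z Z'} hZ hZ' := by
    have h : (fun y ↦ cov'.difference cov y ((Z + Z') y) (Y y))
        = (fun y ↦ cov'.difference cov y (Z y) (Y y))
          + fun y ↦ cov'.difference cov y (Z' y) (Y y) := by
      ext y
      simp
    have h1 := cov'.isCovariantDerivativeOnUniv.add
      (mdifferentiableAt_difference hcov hcov' hY hZ)
      (mdifferentiableAt_difference hcov hcov' hY hZ')
    have h2 := cov'.isCovariantDerivativeOnUniv.add hZ hZ'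
    simp only [derivDifferenceField, h, h1, h2]
    simp
    abel

theorem tensorialAt_derivDifferenceField_right
    (hcov : CovariantDerivative.ContMDiffCovariantDerivative cov ∞)
    (hcov' : CovariantDerivative.ContMDiffCovariantDerivative cov' ∞) (u : TangentSpace I x)
    (hZ : MDiffAt (T% Z) x) :
    TensorialAt I E (derivDifferenceField cov cov' x u Z ·) x where
  smul {f Y} hf hY := by
    have h : (fun y ↦ cov'.difference cov y (Z y) ((f • Y) y))
        = f • fun y ↦ cov'.difference cov y (Z y) (Y y) := by
      ext y
      simp
    have h1 := cov'.isCovariantDerivativeOnUniv.leibniz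
      (mdifferentiableAt_difference hcov hcov' hY hZ) hf
    have h2 := cov'.isCovariantDerivativeOnUniv.leibniz hY hf
    simp only [derivDifferenceField, h, h1, h2]
    simp
    module
  add {Y Y'} hY hY' := by
    have h : (fun y ↦ cov'.difference cov y (Z y) ((Y + Y') y))
        = (fun y ↦ cov'.difference cov y (Z y) (Y y))
          + fun y ↦ cov'.difference cov y (Z y) (Y' y) := by
      ext y
      simp
    have h1 := cov'.isCovariantDerivativeOnUniv.add
      (mdifferentiableAt_difference hcov hcov' hY hZ)
      (mdifferentiableAt_difference hcov hcov' hY' hZ)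
    have h2 := cov'.isCovariantDerivativeOnUniv.add hY hY'
    simp only [derivDifferenceField, h, h1, h2]
    simp
    abel

/-- The tensor `(z, y, u) ↦ (∇'_u A)(z, y)`, for the difference tensor `A = ∇' - ∇`. -/
def derivDifference (hcov : CovariantDerivative.ContMDiffCovariantDerivative cov ∞)
    (hcov' : CovariantDerivative.ContMDiffCovariantDerivative cov' ∞) (x : M) :
    TangentSpace I x →ₗ[ℝ] TangentSpace I x →ₗ[ℝ] TangentSpace I x →ₗ[ℝ] TangentSpace I x :=
  let B (u : TangentSpace I x) := TensorialAt.mkHom₂ (derivDifferenceField cov cov' x u) x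
    (fun _ hY ↦ tensorialAt_derivDifferenceField_left hcov hcov' u hY)
    (fun _ hZ ↦ tensorialAt_derivDifferenceField_right hcov hcov' u hZ)
  LinearMap.mk₂ ℝ
    (fun z y ↦
      { toFun u := B u z y
        map_add' u u' := by
          simp only [B, TensorialAt.mkHom₂_apply_eq_extend, derivDifferenceField]
          simp
          abel
        map_smul' c u := by
          simp only [B, TensorialAt.mkHom₂_apply_eq_extend, derivDifferenceField]
          simp
          module })
    (by intros; ext; simp) (by intros; ext; simp) (by intros; ext; simp) (by intros; ext; simp)

theorem derivDifference_apply (hcov : CovariantDerivative.ContMDiffCovariantDerivative cov ∞)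
    (hcov' : CovariantDerivative.ContMDiffCovariantDerivative cov' ∞) (u : TangentSpace I x)
    (hZ : MDiffAt (T% Z) x) (hY : MDiffAt (T% Y) x) :
    derivDifference hcov hcov' x (Z x) (Y x) u = derivDifferenceField cov cov' x u Z Y :=
  TensorialAt.mkHom₂_apply (Φ := derivDifferenceField cov cov' x u)
    (fun _ hY ↦ tensorialAt_derivDifferenceField_left hcov hcov' u hY)
    (fun _ hZ ↦ tensorialAt_derivDifferenceField_right hcov hcov' u hZ) hZ hY

/-- Substitute `∇ = ∇' - A` in both derivatives. The two terms containing `∇'Z` are together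
symmetric in `u` and `Y x`, so they cancel in the curvature; the term containing `∇'Y` combines with
the bracket into the torsion. -/
theorem apply_covariant_eq_sub_difference
    (hcov : CovariantDerivative.ContMDiffCovariantDerivative cov ∞)
    (hcov' : CovariantDerivative.ContMDiffCovariantDerivative cov' ∞) (u : TangentSpace I x)
    (hY : ∀ᶠ y in 𝓝 x, CMDiffAt ∞ (T% Y) y) (hZ : ∀ᶠ y in 𝓝 x, CMDiffAt ∞ (T% Z) y) :
    cov (fun y ↦ cov Z y (Y y)) x u
      = cov' (fun y ↦ cov' Z y (Y y)) x u - derivDifferenceField cov cov' x u Z Y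
        - cov'.difference cov x (cov' Z x u) (Y x) - cov'.difference cov x (Z x) (cov' Y x u)
        - cov'.difference cov x (cov' Z x (Y x)) u
        + cov'.difference cov x (cov'.difference cov x (Z x) (Y x)) u := by
  have hZ' := hZ.self_of_nhds.mdifferentiableAt (n := ∞) (by simp)
  have hY' := hY.self_of_nhds.mdifferentiableAt (n := ∞) (by simp)
  have d1 : MDiffAt (T% (fun y ↦ cov Z y (Y y))) x :=
    (hcov.eventually_contMDiffAt hY hZ).self_of_nhds.mdifferentiableAt (by simp)
  have d2 : MDiffAt (T% (fun y ↦ cov' Z y (Y y))) x :=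
    (hcov'.eventually_contMDiffAt hY hZ).self_of_nhds.mdifferentiableAt (by simp)
  have d3 := mdifferentiableAt_difference hcov hcov' hY' hZ'
  have h1 : cov' (fun y ↦ cov Z y (Y y)) x = cov' (fun y ↦ cov' Z y (Y y)) x
      - cov' (fun y ↦ cov'.difference cov y (Z y) (Y y)) x := by
    rw [← cov'.apply_sub d2 d3]
    refine cov'.congr_of_eventuallyEq d1 ?_
    filter_upwards [hZ] with y hy
    rw [CovariantDerivative.difference_apply_section (hy.mdifferentiableAt (by simp))]
    simp
  have h2 := congrArg (fun f ↦ f u)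
    (CovariantDerivative.difference_apply_section (cov := cov) (cov' := cov') d1)
  have h3 := congrArg (fun f ↦ f (Y x))
    (CovariantDerivative.difference_apply_section (cov := cov) (cov' := cov') hZ')
  simp only [h1, FunLike.coe_sub, Pi.sub_apply] at h2 h3
  have h4 : cov Z x (Y x) = cov' Z x (Y x) - cov'.difference cov x (Z x) (Y x) := by
    rw [h3]; abel
  rw [h4, map_sub] at h2
  simp only [FunLike.coe_sub, Pi.sub_apply] at h2
  rw [sub_eq_iff_eq_add] at h2
  rw [derivDifferenceField, eq_comm, ← sub_eq_zero]
  rw [eq_comm, ← sub_eq_zero] at h2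
  rw [← h2]
  abel

/-- The curvatures of two smooth connections, compared through their difference tensor. -/
theorem curvatureField_eq_sub_difference
    (hcov : CovariantDerivative.ContMDiffCovariantDerivative cov ∞)
    (hcov' : CovariantDerivative.ContMDiffCovariantDerivative cov' ∞)
    (hX : ∀ᶠ y in 𝓝 x, CMDiffAt ∞ (T% X) y) (hY : ∀ᶠ y in 𝓝 x, CMDiffAt ∞ (T% Y) y)
    (hZ : ∀ᶠ y in 𝓝 x, CMDiffAt ∞ (T% Z) y) :
    curvatureField cov X Y Z x = curvatureField cov' X Y Z x
      - derivDifferenceField cov cov' x (X x) Z Y + derivDifferenceField cov cov' x (Y x) Z X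
      - cov'.difference cov x (Z x) (cov'.torsion x (X x) (Y x))
      + cov'.difference cov x (cov'.difference cov x (Z x) (Y x)) (X x)
      - cov'.difference cov x (cov'.difference cov x (Z x) (X x)) (Y x) := by
  have hX' := hX.self_of_nhds.mdifferentiableAt (n := ∞) (by simp)
  have hY' := hY.self_of_nhds.mdifferentiableAt (n := ∞) (by simp)
  have hZ' := hZ.self_of_nhds.mdifferentiableAt (n := ∞) (by simp)
  have h3 := congrArg (fun f ↦ f (mlieBracket I X Y x))
    (CovariantDerivative.difference_apply_section (cov := cov) (cov' := cov') hZ')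
  simp only [FunLike.coe_sub, Pi.sub_apply] at h3
  rw [curvatureField, curvatureField, apply_covariant_eq_sub_difference hcov hcov' (X x) hY hZ,
    apply_covariant_eq_sub_difference hcov hcov' (Y x) hX hZ, cov'.torsion_apply hX' hY',
    map_sub, map_sub, h3]
  abel

theorem curvatureAt_eq_sub_difference
    (hcov : CovariantDerivative.ContMDiffCovariantDerivative cov ∞)
    (hcov' : CovariantDerivative.ContMDiffCovariantDerivative cov' ∞) (u v w : TangentSpace I x) :
    curvatureAt cov x u v w = curvatureAt cov' x u v w
      - derivDifference hcov hcov' x w v u + derivDifference hcov hcov' x w u v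
      - cov'.difference cov x w (cov'.torsion x u v)
      + cov'.difference cov x (cov'.difference cov x w v) u
      - cov'.difference cov x (cov'.difference cov x w u) v := by
  have h := curvatureField_eq_sub_difference hcov hcov' (eventually_contMDiffAt_extend u)
    (eventually_contMDiffAt_extend v) (eventually_contMDiffAt_extend w)
  simp only [extend_apply_self] at h
  exact h

end DerivativeOfDifference

/-! ### The canonical connection of a `W₃`-manifold. -/

section CanonicalConnection

open Filter Topology

variable {E : Type*} [NormedAddCommGroup E] [NormedSpace ℝ E]
  {H : Type*} [TopologicalSpace H] {I : ModelWithCorners ℝ E H}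
  {M : Type*} [TopologicalSpace M] [ChartedSpace H M] [IsManifold I ∞ M]
  [RiemannianBundle (fun x : M ↦ TangentSpace I x)]
  {P : Π x : M, TangentSpace I x →L[ℝ] TangentSpace I x}
  {cov cov' : CovariantDerivative I E (TangentSpace I : M → Type _)}
  {X Y Z : Π x : M, TangentSpace I x} {x : M}

theorem IsRiemannianAlmostProduct.mdifferentiableAt_apply (hP : IsRiemannianAlmostProduct P)
    (hZ : MDiffAt (T% Z) x) : MDiffAt (T% (fun y ↦ P y (Z y))) x :=
  ((hP.smooth x).mdifferentiableAt (by simp)).clm_bundle_apply hZ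

variable [FiniteDimensional ℝ E]
  [IsContMDiffRiemannianBundle I ∞ E (fun x : M ↦ TangentSpace I x)]

/-- A connection preserving `P` commutes with `P` on all differentiable vector fields. -/
theorem IsNaturalConnection.apply_endo (hcov' : IsNaturalConnection cov' P)
    (hP : IsRiemannianAlmostProduct P) (hZ : MDiffAt (T% Z) x) (u : TangentSpace I x) :
    cov' (fun y ↦ P y (Z y)) x u = P x (cov' Z x u) := by
  -- Parallelism is stated for the chosen extensions of vectors only; tensoriality transfers it to
  -- every differentiable field.
  have tens : TensorialAt I E
      (fun Z : Π x : M, TangentSpace I x ↦ cov' (fun y ↦ P y (Z y)) x u - P x (cov' Z x u)) x :=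
    { smul := fun {f Z} hf hZ ↦ by
        have h : (fun y ↦ P y ((f • Z) y)) = f • fun y ↦ P y (Z y) := by ext y; simp
        have h1 := cov'.isCovariantDerivativeOnUniv.leibniz (hP.mdifferentiableAt_apply hZ) hf
        have h2 := cov'.isCovariantDerivativeOnUniv.leibniz hZ hf
        simp only [h, h1, h2]
        simp
        module
      add := fun {Z Z'} hZ hZ' ↦ by
        have h : (fun y ↦ P y ((Z + Z') y)) = (fun y ↦ P y (Z y)) + fun y ↦ P y (Z' y) := by
          ext y; simp
        have h1 := cov'.isCovariantDerivativeOnUniv.add (hP.mdifferentiableAt_apply hZ)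
          (hP.mdifferentiableAt_apply hZ')
        have h2 := cov'.isCovariantDerivativeOnUniv.add hZ hZ'
        simp only [h, h1, h2]
        simp
        abel }
  have h := tens.pointwise hZ (mdifferentiableAt_extend I E (Z x)) (by simp)
  have h0 := hcov'.parallel x u (Z x)
  rw [covDerivEndo] at h0
  simp only [h0] at h
  exact sub_eq_zero.1 h

theorem covDerivEndo_eq_difference (hcov' : IsNaturalConnection cov' P)
    (hP : IsRiemannianAlmostProduct P) (u v : TangentSpace I x) :
    covDerivEndo cov P x u v
      = P x (cov'.difference cov x v u) - cov'.difference cov x (P x v) u := by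
  have hv := mdifferentiableAt_extend I E v
  have h1 := hcov'.apply_endo hP hv u
  have h2 := congrArg (fun f ↦ f u) (CovariantDerivative.difference_apply_section (cov := cov)
    (cov' := cov') (hP.mdifferentiableAt_apply hv))
  simp only [FunLike.coe_sub, Pi.sub_apply, extend_apply_self, h1] at h2
  rw [covDerivEndo, CovariantDerivative.difference_apply_vector, h2, map_sub]
  abel

theorem torsion_eq_difference (hcov : IsLeviCivita cov) (u v : TangentSpace I x) :
    cov'.torsion x u v = cov'.difference cov x v u - cov'.difference cov x u v := by
  have h := cov.torsion_apply_eq_extend u v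
  rw [hcov.torsion_eq_zero] at h
  simp only [Pi.zero_apply, FunLike.coe_zero, extend_apply_self] at h
  rw [cov'.torsion_apply_eq_extend, CovariantDerivative.difference_apply_vector,
    CovariantDerivative.difference_apply_vector, ← sub_eq_zero]
  simp only [extend_apply_self]
  refine Eq.trans ?_ h.symm
  abel

/-- Both connections compute the same derivative of `⟪V, W⟫`; subtract the two product rules. -/
theorem inner_difference_skew
    (hcov : CovariantDerivative.IsMetricCompatible (V := fun x : M ↦ TangentSpace I x) cov)
    (hcov' : CovariantDerivative.IsMetricCompatible (V := fun x : M ↦ TangentSpace I x) cov')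
    (u v w : TangentSpace I x) :
    inner ℝ (cov'.difference cov x v u) w = -inner ℝ (cov'.difference cov x w u) v := by
  have hv := mdifferentiableAt_extend I E v
  have hw := mdifferentiableAt_extend I E w
  have h := hcov.mvfderiv_inner_eq (extend E u) hv hw
  have h' := hcov'.mvfderiv_inner_eq (extend E u) hv hw
  rw [h] at h'
  simp only [extend_apply_self] at h'
  rw [CovariantDerivative.difference_apply_vector, CovariantDerivative.difference_apply_vector,
    inner_sub_left, inner_sub_left, real_inner_comm v, real_inner_comm v]
  linarith

theorem isW3Difference (hP : IsRiemannianAlmostProduct P) (hcov : IsLeviCivita cov)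
    (hW3 : IsW3 cov P) (hcov' : IsCanonicalConnection cov' P) (x : M) :
    IsW3Difference (P x) (cov'.difference cov x) where
  sq := hP.sq x
  inner_map := hP.inner_map x
  skew u v w := inner_difference_skew hcov.metric hcov'.metric u v w
  cyclic u v w := by
    have h := hW3 x u v w
    simpa only [fundamentalF, covDerivEndo_eq_difference hcov'.toIsNaturalConnection hP] using h
  torsion u v w := by
    have h := hcov'.torsion_identity x u v w
    simpa only [torsion_eq_difference hcov] using h

theorem isParallelEndo_iff_difference_eq_zero (hP : IsRiemannianAlmostProduct P)
    (hcov : IsLeviCivita cov) (hW3 : IsW3 cov P) (hcov' : IsCanonicalConnection cov' P) :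
    IsParallelEndo cov P ↔ ∀ (x : M) (u v : TangentSpace I x), cov'.difference cov x v u = 0 := by
  simp only [IsParallelEndo, covDerivEndo_eq_difference hcov'.toIsNaturalConnection hP]
  exact ⟨fun h x ↦ (isW3Difference hP hcov hW3 hcov' x).eq_zero (h x),
    fun h x u v ↦ by rw [h, h, map_zero, sub_zero]⟩

variable [T2Space M]

/-- Differentiate the skewness of `A` with `∇'`, using `∇'g = 0`. -/
theorem inner_derivDifference_skew (hcov : IsLeviCivita cov) (hcov' : IsNaturalConnection cov' P)
    (u y z w : TangentSpace I x) :
    inner ℝ (derivDifference hcov.smooth hcov'.smooth x z y u) w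
      = -inner ℝ (derivDifference hcov.smooth hcov'.smooth x w y u) z := by
  have hy := mdifferentiableAt_extend I E y
  have hz := mdifferentiableAt_extend I E z
  have hw := mdifferentiableAt_extend I E w
  have hzy := mdifferentiableAt_difference hcov.smooth hcov'.smooth hy hz
  have hwy := mdifferentiableAt_difference hcov.smooth hcov'.smooth hy hw
  have e1 := derivDifference_apply hcov.smooth hcov'.smooth u hz hy
  have e2 := derivDifference_apply hcov.smooth hcov'.smooth u hw hy
  have m1 := hcov'.metric.mvfderiv_inner_eq (extend E u) hzy hw
  have m2 := hcov'.metric.mvfderiv_inner_eq (extend E u) hwy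
    (mdifferentiableAt_neg_section hz)
  -- The sign is carried by the section extending `z`, so that the product rule applies to both
  -- sides.
  have hfun : (fun q ↦ inner ℝ (cov'.difference cov q (extend E z q) (extend E y q))
        (extend E w q))
      = fun q ↦ inner ℝ (cov'.difference cov q (extend E w q) (extend E y q))
        ((-extend E z : Π q : M, TangentSpace I q) q) := by
    ext q
    rw [inner_difference_skew hcov.metric hcov'.metric]
    simp
  have hneg : cov' (-extend E z) x u = -cov' (extend E z) x u := by
    have := cov'.isCovariantDerivativeOnUniv.smul_const (-1) hz
    simpa using congrArg (fun f ↦ f u) this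
  rw [hfun, m2] at m1
  simp only [extend_apply_self, Pi.neg_apply, hneg, inner_neg_right] at m1 e1 e2
  rw [e1, e2, derivDifferenceField, derivDifferenceField]
  simp only [inner_sub_left, extend_apply_self]
  rw [inner_difference_skew hcov.metric hcov'.metric _ (cov' (extend E z) x u) w,
    inner_difference_skew hcov.metric hcov'.metric _ z w,
    inner_difference_skew hcov.metric hcov'.metric _ (cov' (extend E w) x u) z]
  linarith

/-- Differentiate `swap` with `∇'`, which commutes with `P`. -/
theorem derivDifference_swap (hP : IsRiemannianAlmostProduct P) (hcov : IsLeviCivita cov)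
    (hW3 : IsW3 cov P) (hcov' : IsCanonicalConnection cov' P) (u y z : TangentSpace I x) :
    derivDifference hcov.smooth hcov'.smooth x z y u
      = -derivDifference hcov.smooth hcov'.smooth x (P x y) (P x z) u := by
  have hA (q : M) := isW3Difference hP hcov hW3 hcov' q
  have hy := mdifferentiableAt_extend I E y
  have hz := mdifferentiableAt_extend I E z
  have e1 := derivDifference_apply hcov.smooth hcov'.smooth u hz hy
  have e2 := derivDifference_apply hcov.smooth hcov'.smooth u (hP.mdifferentiableAt_apply hy)
    (hP.mdifferentiableAt_apply hz)
  have hfun : (fun q ↦ cov'.difference cov q (P q (extend E y q)) (P q (extend E z q)))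
      = (-1 : ℝ) • fun q ↦ cov'.difference cov q (extend E z q) (extend E y q) := by
    ext q
    rw [Pi.smul_apply, (hA q).swap (extend E z q)]
    simp
  have hneg := congrArg (fun f ↦ f u) (cov'.isCovariantDerivativeOnUniv.smul_const (-1)
    (mdifferentiableAt_difference hcov.smooth hcov'.smooth hy hz))
  simp only [extend_apply_self] at e1 e2
  rw [e1, e2, derivDifferenceField, derivDifferenceField, hfun, hneg,
    hcov'.apply_endo hP hy, hcov'.apply_endo hP hz]
  simp only [extend_apply_self]
  rw [(hA x).swap (cov' (extend E z) x u), (hA x).swap z]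
  simp
  abel

/-- The scalar curvatures of the canonical and of the Levi-Civita connection of a `W₃`-manifold
differ by a third of the squared norm of the difference tensor. -/
theorem exists_scalarCurvatureAt_sub (hP : IsRiemannianAlmostProduct P) (hcov : IsLeviCivita cov)
    (hW3 : IsW3 cov P) (hcov' : IsCanonicalConnection cov' P) (x : M) :
    ∃ (n : ℕ) (e : OrthonormalBasis (Fin n) ℝ (TangentSpace I x)),
      3 * (scalarCurvatureAt cov' x - scalarCurvatureAt cov x)
        = ∑ k, ∑ i, ‖cov'.difference cov x (e k) (e i)‖ ^ 2 := by
  have : FiniteDimensional ℝ (TangentSpace I x) := inferInstanceAs (FiniteDimensional ℝ E)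
  refine ⟨_, stdOrthonormalBasis ℝ (TangentSpace I x), ?_⟩
  exact (isW3Difference hP hcov hW3 hcov' x).sum_curvature_sub _
    (derivDifference hcov.smooth hcov'.smooth x)
    (fun z y u ↦ derivDifference_swap hP hcov hW3 hcov' u y z)
    (fun z y u w ↦ inner_derivDifference_skew hcov hcov'.toIsNaturalConnection u y z w)
    (fun z y u ↦ curvatureAt cov x u y z) (fun z y u ↦ curvatureAt cov' x u y z)
    (fun z y u ↦ by
      rw [curvatureAt_eq_sub_difference hcov.smooth hcov'.smooth, torsion_eq_difference hcov])

end CanonicalConnection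

/-- A Riemannian `W₃`-manifold is a Riemannian `P`-manifold (`∇P = 0`) if and only if the scalar
curvatures of the canonical connection and of the Levi-Civita connection coincide. -/
theorem corollary4p4 {E : Type*} [NormedAddCommGroup E] [NormedSpace ℝ E] [FiniteDimensional ℝ E]
    {M : Type*} [TopologicalSpace M] [T2Space M] [ChartedSpace E M] [IsManifold 𝓘(ℝ, E) ∞ M]
    [RiemannianBundle (fun x : M ↦ TangentSpace 𝓘(ℝ, E) x)]
    [IsContMDiffRiemannianBundle 𝓘(ℝ, E) ∞ E (fun x : M ↦ TangentSpace 𝓘(ℝ, E) x)]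
    (P : Π x : M, TangentSpace 𝓘(ℝ, E) x →L[ℝ] TangentSpace 𝓘(ℝ, E) x)
    (hP : IsRiemannianAlmostProduct P)
    (cov cov' : CovariantDerivative 𝓘(ℝ, E) E (TangentSpace 𝓘(ℝ, E) : M → Type _))
    (hcov : IsLeviCivita cov) (hW3 : IsW3 cov P) (hcov' : IsCanonicalConnection cov' P) :
    IsParallelEndo cov P ↔ ∀ x : M, scalarCurvatureAt cov' x = scalarCurvatureAt cov x := by
  rw [isParallelEndo_iff_difference_eq_zero hP hcov hW3 hcov']
  -- With `∇P = 0` replaced by `A = 0`, the equivalence holds separately at each point.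
  refine forall_congr' fun x ↦ ?_
  obtain ⟨n, e, he⟩ := exists_scalarCurvatureAt_sub hP hcov hW3 hcov' x
  refine ⟨fun h ↦ ?_, fun h ↦ ?_⟩
  · simp only [h, norm_zero] at he
    norm_num at he
    linarith
  · rw [h, sub_self, mul_zero, eq_comm, Finset.sum_eq_zero_iff_of_nonneg fun _ _ ↦
      Finset.sum_nonneg fun _ _ ↦ sq_nonneg _] at he
    have hzero (k i) : cov'.difference cov x (e k) (e i) = 0 := by
      have hk := he k (Finset.mem_univ k)
      rw [Finset.sum_eq_zero_iff_of_nonneg fun _ _ ↦ sq_nonneg _] at hk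
      simpa using hk i (Finset.mem_univ i)
    intro u v
    rw [← e.sum_repr u, ← e.sum_repr v]
    simp [hzero]
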